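/- Let $X$ be a finite set of $n=|X|$ points with a similarity measure $\mu:X^2\to\mathbb{R}$, let $r_1<r_2$ be real and $\rho\in[0,1]$. A hash family $\mathcal{H}$ (a probability distribution over functions $h:X\to B$ into some set of buckets $B$) is called $(r_1,r_2,\rho)$-sensitive for $(X,\mu)$ if for all $p,q\in X$: $\mu(p,q)>r_2$ implies $\Pr_{h\sim\mathcal{H}}[h(p)=h(q)]\ge n^{-\rho}$, and $\mu(p,q)<r_1$ implies $\Pr_{h\sim\mathcal{H}}[h(p)=h(q)]<n^{-4}$. For an integer $\ell\ge 0$, the $\ell$-wise concatenation of $\mathcal{H}$ is the family of functions $p\mapsto(h_1(p),\dots,h_\ell(p))$ with $h_1,\dots,h_\ell\sim\mathcal{H}$ independent. The angular similarity of nonzero $x,y\in\mathbb{R}^d$ is $1-\theta_{x,y}$, where $\theta_{x,y}\in[0,1]$ is the angle between $x$ and $y$ divided by $\pi$; the Jaccard similarity of finite sets $A,B$ is $|A\cap B|/|A\cup B|$ (and $1$ if $A=B=\emptyset$). SimHash is the family $h(x)=\mathrm{sign}\langle x,z\rangle$ with $z$ uniform on the unit sphere of $\mathbb{R}^d$. MinHash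 over a universe $\mathcal{U}$ is the family $h(A)=\min_{u\in A}r_u$ (with $h(\emptyset)=1$), with $(r_u)_{u\in\mathcal{U}}$ independent and uniform on $[0,1]$. **Proposition.** There is an absolute constant $C>0$ such that the following holds for all $\varepsilon,\alpha\in(0,1)$. Let $P$ be either a finite subset of $\mathbb{R}^d\setminus\{0\}$, $d\ge 1$, with $\mu$ the angular similarity, or a finite collection of finite subsets of a universe $\mathcal{U}$, with $\mu$ the Jaccard similarity. Then there exists a $(1-\varepsilon^{-1}\alpha,\;1-\alpha,\;\min\{1,C\varepsilon\})$-sensitive hash family for $(P,\mu)$. Moreover, if $C\varepsilon\le 1$, such a family is obtained as the $\ell$-wise concatenation, for some integer $\ell\ge 0$, of SimHash in the angular case and of MinHash in the Jaccard case. -/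

import Mathlib

open MeasureTheory

universe u

/-- A family of hash functions `X → Bucket`, with a probability distribution on it: `hash ω` is the
function drawn with randomness `ω`.  Collision events are measurable. -/
structure HashFamily (X : Type u) where
  Ω : Type u
  [measurableSpace : MeasurableSpace Ω]
  prob : Measure Ω
  [isProbabilityMeasure : IsProbabilityMeasure prob]
  Bucket : Type
  hash : Ω → X → Bucket
  measurableSet_collision : ∀ p q, MeasurableSet {ω | hash ω p = hash ω q}

attribute [instance] HashFamily.measurableSpace HashFamily.isProbabilityMeasure

namespace HashFamily

/-- The probability, over the draw of `h`, that `h p = h q`. -/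
noncomputable def collisionProb {X : Type u} (H : HashFamily X) (p q : X) : ℝ :=
  H.prob.real {ω | H.hash ω p = H.hash ω q}

/-- `(r₁, r₂, ρ)`-sensitivity of a hash family for the finite point set `X` with similarity `μ`,
where `n = |X|`. -/
def IsSensitive {X : Type u} [Fintype X] (H : HashFamily X) (μ : X → X → ℝ) (r₁ r₂ ρ : ℝ) : Prop :=
  r₁ < r₂ ∧ 0 ≤ ρ ∧ ρ ≤ 1 ∧
    ∀ p q : X,
      (r₂ < μ p q → (Fintype.card X : ℝ) ^ (-ρ) ≤ H.collisionProb p q) ∧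
      (μ p q < r₁ → H.collisionProb p q < (Fintype.card X : ℝ) ^ (-4 : ℝ))

/-- The family of `ℓ`-wise concatenations `p ↦ (h₁ p, …, h_ℓ p)`, with `h₁, …, h_ℓ` drawn
independently from `H`. -/
noncomputable def concat {X : Type u} (H : HashFamily X) (l : ℕ) : HashFamily X where
  Ω := Fin l → H.Ω
  prob := Measure.pi fun _ => H.prob
  Bucket := Fin l → H.Bucket
  hash ω p i := H.hash (ω i) p
  measurableSet_collision p q := by
    have h : {ω : Fin l → H.Ω | (fun i => H.hash (ω i) p) = fun i => H.hash (ω i) q} =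
        ⋂ i, (fun ω : Fin l → H.Ω => ω i) ⁻¹' {ω | H.hash ω p = H.hash ω q} := by
      ext ω
      simp [funext_iff]
    rw [h]
    exact MeasurableSet.iInter fun i => measurable_pi_apply i (H.measurableSet_collision p q)

end HashFamily

/-- Angular similarity `1 - θ`, where `θ ∈ [0, 1]` is the angle divided by `π`. -/
noncomputable def angularSim {d : ℕ} (x y : EuclideanSpace ℝ (Fin d)) : ℝ :=
  1 - InnerProductGeometry.angle x y / Real.pi

/-- Jaccard similarity `|A ∩ B| / |A ∪ B|` of finite sets, equal to `1` for two empty sets. -/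
noncomputable def jaccardSim {U : Type u} [DecidableEq U] (A B : Finset U) : ℝ :=
  if A ∪ B = ∅ then 1 else ((A ∩ B).card : ℝ) / ((A ∪ B).card : ℝ)

/-- The uniform probability distribution on the unit sphere of `ℝ^d`. -/
noncomputable def uniformSphere (d : ℕ) :
    Measure (Metric.sphere (0 : EuclideanSpace ℝ (Fin d)) 1) :=
  ((volume : Measure (EuclideanSpace ℝ (Fin d))).toSphere Set.univ)⁻¹ •
    (volume : Measure (EuclideanSpace ℝ (Fin d))).toSphere

instance (d : ℕ) [NeZero d] : IsProbabilityMeasure (uniformSphere d) := by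
  have : NeZero (volume : Measure (EuclideanSpace ℝ (Fin d))).toSphere := by
    refine ⟨?_⟩
    rw [Ne, ← Measure.measure_univ_eq_zero, Measure.toSphere_apply_univ]
    simp [NeZero.ne d, (Metric.measure_ball_pos volume (0 : EuclideanSpace ℝ (Fin d))
      one_pos).ne']
  unfold uniformSphere
  infer_instance

/-- SimHash on the points of `P`: draw `z` uniformly from the unit sphere and put
`h x = sign ⟪x, z⟫`. -/
noncomputable def simHash {d : ℕ} [NeZero d] (P : Finset (EuclideanSpace ℝ (Fin d))) :
    HashFamily P where
  Ω := Metric.sphere (0 : EuclideanSpace ℝ (Fin d)) 1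
  prob := uniformSphere d
  Bucket := SignType
  hash z x := SignType.sign (inner ℝ (x : EuclideanSpace ℝ (Fin d)) (z : EuclideanSpace ℝ (Fin d)))
  measurableSet_collision p q := by
    have hm : ∀ x : EuclideanSpace ℝ (Fin d), Measurable
        fun z : Metric.sphere (0 : EuclideanSpace ℝ (Fin d)) 1 =>
          inner ℝ x (z : EuclideanSpace ℝ (Fin d)) := fun x => by fun_prop
    have h : ∀ a b : ℝ, SignType.sign a = SignType.sign b ↔
        (0 < a ↔ 0 < b) ∧ (a < 0 ↔ b < 0) := by
      intro a b
      rcases lt_trichotomy a 0 with ha | ha | ha <;> rcases lt_trichotomy b 0 with hb | hb | hb <;>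
        simp [ha, hb, ha.le, hb.le, not_lt.2, sign_neg, sign_pos]
    simp only [h]
    exact ((measurableSet_lt measurable_const (hm _)).iff
      (measurableSet_lt measurable_const (hm _))).inter
      ((measurableSet_lt (hm _) measurable_const).iff (measurableSet_lt (hm _) measurable_const))

/-- MinHash on the finite sets in `P`: draw independent uniform numbers `r u ∈ [0, 1]`, one for each
`u : U`, and put `h A = min_{u ∈ A} r u` (which is `1` for the empty set). -/
noncomputable def minHash {U : Type u} (P : Finset (Finset U)) : HashFamily P where
  Ω := U → unitInterval
  prob := Measure.infinitePi fun _ => (volume : Measure unitInterval)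
  Bucket := unitInterval
  hash r A := (A : Finset U).inf r
  measurableSet_collision p q := by
    have hm : ∀ A : Finset U, Measurable fun r : U → unitInterval => A.inf r := by
      classical
      intro A
      induction A using Finset.induction_on with
      | empty => simp
      | insert a s ha ih =>
        simp only [Finset.inf_insert]
        exact (measurable_pi_apply a).inf ih
    exact measurableSet_eq_fun (hm _) (hm _)

/-! For both similarities the base family collides with probability exactly the similarity, so the
`l`-wise concatenation collides with probability `μ p q ^ l` (`collisionProb_concat`). Taking `l`
about `4 ε log n / α` gives `(1 - α / ε) ^ l ≤ exp (-l α / ε) ≤ n ^ (-4)` on far pairs. On close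
pairs, `(1 - α) ^ l ≥ exp (-2 α l)` costs only an exponent `O(ε)`, rounding included. This is
`exists_concat_isSensitive`, with constant `12`.

When `12 ε > 1` only exponent `1` is required, and no relation between hashing and similarity is
needed: a random partial matching of the points merges each close pair with probability at least `1
/ n` and never merges a far one (`exists_isSensitive_one`).

MinHash: almost surely the values on `A ∪ B` have a unique minimizer, uniform by symmetry, and the
hashes agree exactly when it lies in `A ∩ B` (`collisionProb_minHash`).

SimHash: the hyperplane orthogonal to a random `z` separates `x` and `y` with probability
proportional to their angle. No integration in polar coordinates is used: the separating volume is
invariant under rotation in the plane of `x` and `y` and additive in the angle, and a nonnegative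
additive function is linear (`measureReal_sepSet`). The constant is fixed by antipodal vectors,
which are almost surely separated. -/

open scoped Pointwise

/-! ### Concatenation, and the matching family of exponent 1 -/

namespace HashFamily

theorem collisionProb_concat {X : Type u} (H : HashFamily X) (l : ℕ) (p q : X) :
    (H.concat l).collisionProb p q = H.collisionProb p q ^ l := by
  have h : {ω : Fin l → H.Ω | (fun i => H.hash (ω i) p) = fun i => H.hash (ω i) q} =
      Set.univ.pi fun _ => {ω | H.hash ω p = H.hash ω q} := by
    ext ω
    simp [funext_iff]
  change (Measure.pi fun _ : Fin l => H.prob).real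
    {ω : Fin l → H.Ω | (fun i => H.hash (ω i) p) = fun i => H.hash (ω i) q} = _
  rw [h, Measure.real, Measure.pi_pi]
  simp [collisionProb, Measure.real]

/-- Draw `c` uniformly from `ZMod |X|` and merge the two points of each pair `p, q` with
`p + q = c` whenever `close p q`. -/
noncomputable def matching {X : Type u} [Fintype X] [Nonempty X] (close : X → X → Prop) :
    HashFamily X :=
  haveI : NeZero (Fintype.card X) := ⟨Fintype.card_ne_zero⟩
  let e : X ≃ ZMod (Fintype.card X) := (Fintype.equivFin X).trans (ZMod.finEquiv _).toEquiv
  letI : MeasurableSpace X := ⊤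
  haveI : MeasurableSingletonClass X := ⟨fun _ => trivial⟩
  open scoped Classical in
  { Ω := X
    prob := ProbabilityTheory.uniformOn Set.univ
    isProbabilityMeasure :=
      ProbabilityTheory.isProbabilityMeasure_uniformOn Set.finite_univ Set.univ_nonempty
    -- Buckets must live in `Type`, so points are labelled by residues. The unordered pair is the
    -- same for `p` and its partner `c - p`; an unmatched point gets its own diagonal bucket.
    Bucket := Sym2 (ZMod (Fintype.card X))
    hash := fun c p =>
      if close p (e.symm (e c - e p)) ∧ close (e.symm (e c - e p)) p then s(e p, e c - e p)
      else s(e p, e p)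
    measurableSet_collision := fun _ _ => trivial }

/-- The single draw `c = p + q` already merges `p` and `q`, and it has probability `1 / n`. -/
theorem collisionProb_matching_of_close {X : Type u} [Fintype X] [Nonempty X]
    (close : X → X → Prop) {p q : X} (h : close p q) (h' : close q p) :
    (Fintype.card X : ℝ)⁻¹ ≤ (matching close).collisionProb p q := by
  classical
  have : NeZero (Fintype.card X) := ⟨Fintype.card_ne_zero⟩
  let e : X ≃ ZMod (Fintype.card X) := (Fintype.equivFin X).trans (ZMod.finEquiv _).toEquiv
  let : MeasurableSpace X := ⊤
  have : MeasurableSingletonClass X := ⟨fun _ => trivial⟩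
  have hp : IsProbabilityMeasure (ProbabilityTheory.uniformOn (Set.univ : Set X)) :=
    ProbabilityTheory.isProbabilityMeasure_uniformOn Set.finite_univ Set.univ_nonempty
  have key : (ProbabilityTheory.uniformOn (Set.univ : Set X)).real {e.symm (e p + e q)} ≤
      (matching close).collisionProb p q := by
    change _ ≤ (ProbabilityTheory.uniformOn (Set.univ : Set X)).real
      {ω | (matching close).hash ω p = (matching close).hash ω q}
    refine measureReal_mono ?_
    rintro _ rfl
    change (if close p (e.symm (e (e.symm (e p + e q)) - e p)) ∧
        close (e.symm (e (e.symm (e p + e q)) - e p)) p then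
        s(e p, e (e.symm (e p + e q)) - e p) else s(e p, e p)) =
      (if close q (e.symm (e (e.symm (e p + e q)) - e q)) ∧
        close (e.symm (e (e.symm (e p + e q)) - e q)) q then
        s(e q, e (e.symm (e p + e q)) - e q) else s(e q, e q))
    simp [h, h']
  refine le_trans (le_of_eq ?_) key
  rw [Measure.real, ProbabilityTheory.uniformOn_univ]
  simp

/-- Distinct points share a bucket only as the two ends of one matched pair, and matched pairs are
close. -/
theorem collisionProb_matching_of_not_close {X : Type u} [Fintype X] [Nonempty X]
    (close : X → X → Prop) {p q : X} (hpq : p ≠ q) (h : ¬ close p q) :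
    (matching close).collisionProb p q = 0 := by
  classical
  have : NeZero (Fintype.card X) := ⟨Fintype.card_ne_zero⟩
  let e : X ≃ ZMod (Fintype.card X) := (Fintype.equivFin X).trans (ZMod.finEquiv _).toEquiv
  have : {ω | (matching close).hash ω p = (matching close).hash ω q} = ∅ := by
    rw [Set.eq_empty_iff_forall_notMem]
    intro c hc
    change (if close p (e.symm (e c - e p)) ∧ close (e.symm (e c - e p)) p then
        s(e p, e c - e p) else s(e p, e p)) =
      (if close q (e.symm (e c - e q)) ∧ close (e.symm (e c - e q)) q then
        s(e q, e c - e q) else s(e q, e q)) at hc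
    have hne : e p ≠ e q := fun h => hpq (e.injective h)
    split_ifs at hc with h1 h2 h2
    · rcases Sym2.eq_iff.1 hc with h3 | h3
      · exact hne h3.1
      · rw [h3.2, e.symm_apply_apply] at h1
        exact h h1.1
    · rcases Sym2.eq_iff.1 hc with h3 | h3 <;> exact hne h3.1
    · rcases Sym2.eq_iff.1 hc with h3 | h3
      · exact hne h3.1
      · exact hne h3.2
    · rcases Sym2.eq_iff.1 hc with h3 | h3 <;> exact hne h3.1
  rw [collisionProb, this, measureReal_empty]

theorem collisionProb_self {X : Type u} (H : HashFamily X) (p : X) : H.collisionProb p p = 1 := by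
  simp [collisionProb]

/-- A symmetric similarity that equals `1` on the diagonal has a hash family of exponent `1`. -/
theorem exists_isSensitive_one {X : Type u} [Fintype X] (μ : X → X → ℝ) (hμ : ∀ p, μ p p = 1)
    (hsymm : ∀ p q, μ p q = μ q p) {r₁ r₂ : ℝ} (hr : r₁ < r₂) (hr₂ : r₂ ≤ 1) :
    ∃ H : HashFamily X, H.IsSensitive μ r₁ r₂ 1 := by
  rcases isEmpty_or_nonempty X with hX | hX
  · exact ⟨⟨PUnit, Measure.dirac PUnit.unit, Unit, fun _ _ => (), fun p => hX.elim p⟩,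
      hr, zero_le_one, le_rfl, fun p => hX.elim p⟩
  · refine ⟨matching fun p q => r₂ < μ p q, hr, zero_le_one, le_rfl, fun p q => ⟨fun h => ?_,
      fun h => ?_⟩⟩
    · rw [Real.rpow_neg_one]
      exact collisionProb_matching_of_close _ h (by rwa [hsymm])
    · rw [collisionProb_matching_of_not_close _ _ (by linarith)]
      · have := Fintype.card_pos (α := X)
        positivity
      · rintro rfl
        rw [hμ] at h
        linarith

/-- Concatenating a family whose collision probability is the similarity gives the exponent
`12 * ε`. -/
theorem exists_concat_isSensitive {X : Type u} [Fintype X] (H : HashFamily X) (μ : X → X → ℝ)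
    (hH : ∀ p q, H.collisionProb p q = μ p q) {ε α : ℝ} (hε : 0 < ε) (hα : 0 < α)
    (hC : 12 * ε ≤ 1) :
    ∃ l : ℕ, (H.concat l).IsSensitive μ (1 - ε⁻¹ * α) (1 - α) (12 * ε) := by
  have hμ0 : ∀ p q, 0 ≤ μ p q := fun p q => hH p q ▸ measureReal_nonneg
  have hμ1 : ∀ p, μ p p = 1 := fun p => by rw [← hH, collisionProb_self]
  have hr : 1 - ε⁻¹ * α < 1 - α := by
    have : 1 < ε⁻¹ := (one_lt_inv₀ hε).2 (by linarith)
    nlinarith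
  suffices h : ∃ l : ℕ, ∀ p q : X,
      (1 - α < μ p q → (Fintype.card X : ℝ) ^ (-(12 * ε)) ≤ μ p q ^ l) ∧
      (μ p q < 1 - ε⁻¹ * α → μ p q ^ l < (Fintype.card X : ℝ) ^ (-4 : ℝ)) by
    obtain ⟨l, hl⟩ := h
    refine ⟨l, hr, by positivity, hC, fun p q => ?_⟩
    rw [collisionProb_concat, hH]
    exact hl p q
  rcases subsingleton_or_nontrivial X with hX | hX
  -- With at most one point both bounds equal `1`, and no pair is far because `μ p p = 1`.
  · refine ⟨0, fun p q => ?_⟩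
    obtain rfl := Subsingleton.elim p q
    have : Fintype.card X = 1 := Fintype.card_eq_one_iff.2 ⟨p, fun y => Subsingleton.elim _ _⟩
    refine ⟨fun _ => by simp [this], fun h => ?_⟩
    rw [hμ1] at h
    have : 0 < ε⁻¹ * α := by positivity
    linarith
  have hn : (2 : ℝ) ≤ Fintype.card X := by exact_mod_cast Fintype.one_lt_card (α := X)
  set n : ℝ := (Fintype.card X : ℝ)
  have hn0 : 0 < n := by linarith
  -- This absorbs the rounding of `l`: for `α < ε` it gives `l α ≤ 4 ε log n + α ≤ 6 ε log n`, and
  -- doubling yields the constant `12`.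
  have hlog : 1 / 2 < Real.log n :=
    lt_of_lt_of_le (by linarith [Real.log_two_gt_d9]) (Real.log_le_log two_pos hn)
  rcases le_or_gt ε α with hαε | hαε
  -- Here `1 - α / ε ≤ 0`, so no pair is far and the empty concatenation suffices.
  · refine ⟨0, fun p q => ⟨fun _ => ?_, fun h => ?_⟩⟩
    · rw [pow_zero]
      exact Real.rpow_le_one_of_one_le_of_nonpos (by linarith) (by linarith)
    · have h1 : 1 ≤ ε⁻¹ * α := by
        rw [inv_mul_eq_div, one_le_div hε]
        exact hαε
      linarith [hμ0 p q]
  have hx : 0 < 4 * Real.log n * ε / α := by positivity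
  refine ⟨⌈4 * Real.log n * ε / α⌉₊, fun p q => ⟨fun h => ?_, fun h => ?_⟩⟩
  · set l := ⌈4 * Real.log n * ε / α⌉₊
    have hl : (l : ℝ) * α ≤ 4 * Real.log n * ε + α := by
      have := (Nat.ceil_lt_add_one hx.le).le
      calc (l : ℝ) * α ≤ (4 * Real.log n * ε / α + 1) * α := by gcongr
        _ = _ := by field_simp
    -- Valid because `α < ε ≤ 1 / 12`: `(1 - α) (1 + 2 α) ≥ 1` as soon as `α ≤ 1 / 2`.
    have hexp : Real.exp (-(2 * α)) ≤ 1 - α := by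
      rw [Real.exp_neg]
      apply inv_le_of_inv_le₀ (by linarith)
      refine le_trans ?_ (Real.add_one_le_exp (2 * α))
      rw [inv_le_iff_one_le_mul₀ (by linarith)]
      nlinarith
    calc n ^ (-(12 * ε)) = Real.exp (Real.log n * -(12 * ε)) := Real.rpow_def_of_pos hn0 _
      _ ≤ Real.exp ((l : ℝ) * -(2 * α)) := by
        apply Real.exp_le_exp.2
        nlinarith
      _ = Real.exp (-(2 * α)) ^ l := Real.exp_nat_mul _ _
      _ ≤ μ p q ^ l := by
        gcongr
        linarith
  · set l := ⌈4 * Real.log n * ε / α⌉₊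
    have hl : 4 * Real.log n * ε / α ≤ l := Nat.le_ceil _
    calc μ p q ^ l < (1 - ε⁻¹ * α) ^ l :=
        pow_lt_pow_left₀ h (hμ0 p q) (Nat.ceil_pos.2 hx).ne'
      _ ≤ Real.exp (-(ε⁻¹ * α)) ^ l := by
        gcongr
        · linarith [hμ0 p q]
        · linarith [Real.add_one_le_exp (-(ε⁻¹ * α))]
      _ = Real.exp (l * -(ε⁻¹ * α)) := (Real.exp_nat_mul _ _).symm
      _ ≤ Real.exp (Real.log n * -4) := by
        apply Real.exp_le_exp.2
        have : 4 * Real.log n * ε / α * (ε⁻¹ * α) ≤ l * (ε⁻¹ * α) := by gcongr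
        have h2 : 4 * Real.log n * ε / α * (ε⁻¹ * α) = 4 * Real.log n := by field_simp
        linarith
      _ = n ^ (-4 : ℝ) := (Real.rpow_def_of_pos hn0 _).symm

end HashFamily

/-! ### MinHash and Jaccard similarity -/

/-- Two distinct coordinates of a product of atomless probability spaces almost surely differ. -/
theorem measure_infinitePi_eq_eval {U : Type*} {u v : U} (h : u ≠ v) :
    Measure.infinitePi (fun _ : U => (volume : Measure unitInterval)) {r | r u = r v} = 0 := by
  have hd : MeasurableSet {x : unitInterval × unitInterval | x.1 = x.2} :=
    measurableSet_eq_fun measurable_fst measurable_snd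
  have := Measure.infinitePi_map_eval_prod (P := fun _ : U => (volume : Measure unitInterval)) h
  have h2 := congrArg (fun m => m {x : unitInterval × unitInterval | x.1 = x.2}) this
  rw [Measure.map_apply (by fun_prop) hd, Measure.prod_apply hd] at h2
  refine h2.trans ?_
  simp [Set.preimage]

/-- The event that `u` has the strictly smallest value over `insert u S`, and this value is not
`1`. -/
def argminSet {U : Type*} (S : Finset U) (u : U) : Set (U → unitInterval) :=
  {r | r u < 1 ∧ ∀ v ∈ S, v ≠ u → r u < r v}

theorem measurableSet_argminSet {U : Type*} (S : Finset U) (u : U) :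
    MeasurableSet (argminSet S u) := by
  have : argminSet S u = {r | r u < 1} ∩ ⋂ v ∈ S, ⋂ _ : v ≠ u, {r | r u < r v} := by
    ext r
    simp [argminSet]
  rw [this]
  refine (measurableSet_lt (measurable_pi_apply u) measurable_const).inter
    (S.measurableSet_biInter fun v _ => MeasurableSet.iInter fun _ =>
      measurableSet_lt (measurable_pi_apply u) (measurable_pi_apply v))

/-- Swapping the coordinates `u` and `v` preserves the product measure and exchanges the two events.
-/
theorem measure_argminSet_eq {U : Type*} [DecidableEq U] {S : Finset U} {u v : U} (hu : u ∈ S)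
    (hv : v ∈ S) :
    Measure.infinitePi (fun _ : U => (volume : Measure unitInterval)) (argminSet S u) =
      Measure.infinitePi (fun _ : U => (volume : Measure unitInterval)) (argminSet S v) := by
  have h := Measure.map_infinitePi_infinitePi_of_inj
    (P := fun _ : U => (volume : Measure unitInterval)) (Equiv.swap u v).injective
  conv_lhs => rw [← h, Measure.map_apply (by fun_prop) (measurableSet_argminSet S u)]
  congr 1
  ext r
  simp only [argminSet, Set.mem_preimage, Set.mem_ofPred_eq, Equiv.swap_apply_left]
  refine and_congr_right fun _ => ⟨fun H w hw hwv => ?_, fun H w hw hwu => ?_⟩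
  · have hmem : Equiv.swap u v w ∈ S := by
      rw [Equiv.swap_apply_def]
      split_ifs <;> assumption
    have hne : Equiv.swap u v w ≠ u := by
      rwa [Ne, Equiv.swap_apply_eq_iff, Equiv.swap_apply_left]
    simpa using H _ hmem hne
  · refine H _ ?_ ?_
    · rw [Equiv.swap_apply_def]
      split_ifs <;> assumption
    · rwa [Ne, Equiv.swap_apply_eq_iff, Equiv.swap_apply_right]

theorem pairwiseDisjoint_argminSet {U : Type*} (S : Finset U) :
    (S : Set U).PairwiseDisjoint (argminSet S) := by
  intro u hu v hv huv
  refine Set.disjoint_left.2 fun r h1 h2 => ?_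
  exact lt_asymm (h1.2 v hv huv.symm) (h2.2 u hu huv)

theorem ae_exists_mem_argminSet {U : Type*} {S : Finset U} (hS : S.Nonempty) :
    ∀ᵐ r ∂Measure.infinitePi (fun _ : U => (volume : Measure unitInterval)),
      ∃ u ∈ S, r ∈ argminSet S u := by
  have h1 : ∀ᵐ r ∂Measure.infinitePi (fun _ : U => (volume : Measure unitInterval)),
      ∀ u : S, r u ≠ 1 := by
    refine ae_all_iff.2 fun u => ?_
    have := (measurePreserving_eval_infinitePi
      (fun _ : U => (volume : Measure unitInterval)) (u : U)).measure_preimage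
        (measurableSet_singleton (1 : unitInterval)).nullMeasurableSet
    rw [measure_singleton] at this
    rw [ae_iff]
    simpa [Set.preimage] using this
  have h2 : ∀ᵐ r ∂Measure.infinitePi (fun _ : U => (volume : Measure unitInterval)),
      ∀ u v : S, u ≠ v → r u ≠ r v := by
    refine ae_all_iff.2 fun u => ae_all_iff.2 fun v => ?_
    by_cases huv : u = v
    · simp [huv]
    · have : (u : U) ≠ v := fun h => huv (Subtype.ext h)
      simpa [ae_iff, huv] using measure_infinitePi_eq_eval this
  filter_upwards [h1, h2] with r hr1 hr2
  obtain ⟨u, hu, hmin⟩ := S.exists_min_image r hS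
  refine ⟨u, hu, lt_of_le_of_ne le_top (hr1 ⟨u, hu⟩), fun v hv hvu => ?_⟩
  refine lt_of_le_of_ne (hmin v hv) (hr2 ⟨u, hu⟩ ⟨v, hv⟩ ?_)
  exact fun h => hvu (congrArg Subtype.val h).symm

/-- The argmin events over `S` are disjoint, equiprobable and almost surely exhaustive. -/
theorem measureReal_argminSet {U : Type*} [DecidableEq U] {S : Finset U} {u : U} (hu : u ∈ S) :
    (Measure.infinitePi (fun _ : U => (volume : Measure unitInterval))).real (argminSet S u) =
      (S.card : ℝ)⁻¹ := by
  set m := Measure.infinitePi (fun _ : U => (volume : Measure unitInterval))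
  have h1 : m.real (⋃ v ∈ S, argminSet S v) = 1 := by
    rw [measureReal_congr (t := Set.univ)]
    · simp
    · rw [Filter.eventuallyEq_univ]
      filter_upwards [ae_exists_mem_argminSet ⟨u, hu⟩] with r hr
      simpa using hr
  rw [measureReal_biUnion_finset (pairwiseDisjoint_argminSet S)
    fun v _ => measurableSet_argminSet S v] at h1
  rw [Finset.sum_congr rfl fun v hv =>
    show m.real _ = m.real (argminSet S u) from
      congrArg ENNReal.toReal (measure_argminSet_eq hv hu)] at h1
  rw [Finset.sum_const, nsmul_eq_mul] at h1
  exact eq_inv_of_mul_eq_one_right h1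

/-- A subset of `A ∪ B` attains the value `r u` if it contains the minimizer `u`, and otherwise has
a strictly larger infimum. -/
theorem inf_eq_inf_iff_of_mem_argminSet {U : Type*} [DecidableEq U] {A B : Finset U} {u : U}
    {r : U → unitInterval} (hu : u ∈ A ∪ B) (hr : r ∈ argminSet (A ∪ B) u) :
    A.inf r = B.inf r ↔ u ∈ A ∩ B := by
  have hle : ∀ C ⊆ A ∪ B, u ∈ C → C.inf r = r u := fun C hC huC =>
    le_antisymm (Finset.inf_le huC) <| Finset.le_inf fun v hv => by
      by_cases h : v = u
      · rw [h]
      · exact (hr.2 v (hC hv) h).le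
  have hlt : ∀ C ⊆ A ∪ B, u ∉ C → r u < C.inf r := fun C hC huC => by
    -- The condition `r u < 1` matters when `C` is empty, whose infimum is `1`.
    refine (Finset.lt_inf_iff (lt_of_lt_of_le hr.1 le_top)).2 fun v hv => ?_
    exact hr.2 v (hC hv) fun h => huC (h ▸ hv)
  by_cases hA : u ∈ A <;> by_cases hB : u ∈ B
  · simp [hA, hB, hle A Finset.subset_union_left, hle B Finset.subset_union_right]
  · simp [hB, hle A Finset.subset_union_left hA, (hlt B Finset.subset_union_right hB).ne]
  · simp [hA, hle B Finset.subset_union_right hB, (hlt A Finset.subset_union_left hA).ne']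
  · exact absurd hu (by simp [hA, hB])

theorem collisionProb_minHash {U : Type u} [DecidableEq U] (P : Finset (Finset U)) (A B : P) :
    (minHash P).collisionProb A B = jaccardSim (A : Finset U) B := by
  obtain ⟨A, hA⟩ := A
  obtain ⟨B, hB⟩ := B
  unfold jaccardSim
  split_ifs with hS
  · obtain ⟨rfl, rfl⟩ := Finset.union_eq_empty.1 hS
    simp [HashFamily.collisionProb]
  · change (Measure.infinitePi (fun _ : U => (volume : Measure unitInterval))).real
      {r | A.inf r = B.inf r} = _
    have hS' : (A ∪ B).Nonempty := Finset.nonempty_iff_ne_empty.2 hS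
    have hsub : A ∩ B ⊆ A ∪ B := Finset.inter_subset_union
    rw [measureReal_congr (t := ⋃ u ∈ A ∩ B, argminSet (A ∪ B) u),
      measureReal_biUnion_finset
        ((pairwiseDisjoint_argminSet (A ∪ B)).subset (by exact_mod_cast hsub))
        fun v _ => measurableSet_argminSet _ v,
      Finset.sum_congr rfl fun v hv => measureReal_argminSet (hsub hv), Finset.sum_const,
      nsmul_eq_mul, div_eq_mul_inv]
    refine Filter.eventuallyEq_set.2 ?_
    filter_upwards [ae_exists_mem_argminSet hS'] with r hr
    obtain ⟨u, hu, hur⟩ := hr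
    refine (inf_eq_inf_iff_of_mem_argminSet hu hur).trans ?_
    simp only [Set.mem_iUnion, exists_prop]
    refine ⟨fun h => ⟨u, h, hur⟩, fun ⟨v, hv, hvr⟩ => ?_⟩
    by_contra h
    have huv : u ≠ v := fun e => h (e ▸ hv)
    exact Set.disjoint_left.1 (pairwiseDisjoint_argminSet (A ∪ B) hu (hsub hv) huv) hur hvr

/-! ### Additive functions on an interval -/

/-- A nonnegative function which is additive on `[0, L]` is linear there. -/
theorem eq_div_mul_of_additive_of_nonneg {g : ℝ → ℝ} {L : ℝ} (hL : 0 < L)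
    (h0 : ∀ t, 0 ≤ g t)
    (hadd : ∀ a b, 0 ≤ a → 0 ≤ b → a + b ≤ L → g (a + b) = g a + g b) {t : ℝ} (ht : 0 ≤ t)
    (htL : t ≤ L) : g t = t / L * g L := by
  rcases htL.eq_or_lt with rfl | htL
  · rw [div_self hL.ne', one_mul]
  have hmono : ∀ a b, 0 ≤ a → a ≤ b → b ≤ L → g a ≤ g b := fun a b ha hab hb => by
    have := hadd a (b - a) ha (by linarith) (by linarith)
    rw [add_sub_cancel] at this
    linarith [h0 (b - a)]
  have hmul : ∀ s, 0 ≤ s → ∀ k : ℕ, (k + 1 : ℝ) * s ≤ L → g ((k + 1 : ℝ) * s) = (k + 1) * g s := by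
    intro s hs k
    induction k with
    | zero => simp
    | succ k ih =>
      intro h
      push_cast at h ⊢
      rw [show ((k : ℝ) + 1 + 1) * s = (k + 1) * s + s by ring,
        hadd _ _ (by positivity) hs (by linarith), ih (by linarith)]
      ring
  have hzero : g 0 = 0 := by
    have := hadd 0 0 le_rfl le_rfl (by linarith)
    rw [add_zero] at this
    linarith
  have hmul' : ∀ n k : ℕ, k ≤ n + 1 → g (k * (L / (n + 1))) = k / (n + 1) * g L := by
    intro n k hk
    have hn : (0 : ℝ) < n + 1 := by positivity
    have h1 := hmul (L / (n + 1)) (by positivity) n (by rw [mul_div_cancel₀ _ hn.ne'])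
    rw [mul_div_cancel₀ _ hn.ne'] at h1
    rcases k with _ | k
    · simp [hzero]
    · have h2 := hmul (L / (n + 1)) (by positivity) k (by
        rw [mul_div_assoc', div_le_iff₀ hn, mul_comm]
        have : (k : ℝ) + 1 ≤ n + 1 := by exact_mod_cast hk
        gcongr)
      push_cast
      rw [h2, h1]
      field_simp
  -- By monotonicity, `g t` is squeezed between the values at adjacent multiples of `L / (n + 1)`,
  -- where linearity is known.
  have hbound : ∀ n : ℕ, |g t - t / L * g L| ≤ g L * (1 / ((n : ℝ) + 1)) := by
    intro n
    have hn : (0 : ℝ) < n + 1 := by positivity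
    have hx : 0 ≤ (n + 1) * t / L := by positivity
    set k := ⌊(n + 1) * t / L⌋₊
    have hk1 : (k : ℝ) ≤ (n + 1) * t / L := Nat.floor_le hx
    have hk2 : (n + 1) * t / L < k + 1 := Nat.lt_floor_add_one _
    have hkn : k < n + 1 := by
      rw [Nat.floor_lt hx, div_lt_iff₀ hL]
      push_cast
      gcongr
    have e1 := hmul' n k hkn.le
    have e2 := hmul' n (k + 1) hkn
    have hk1' : (k : ℝ) / (n + 1) ≤ t / L := by
      rw [div_le_div_iff₀ hn hL]
      rw [le_div_iff₀ hL] at hk1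
      linarith
    have hk2' : t / L ≤ ((k + 1 : ℕ) : ℝ) / (n + 1) := by
      push_cast
      rw [div_le_div_iff₀ hL hn]
      rw [div_lt_iff₀ hL] at hk2
      linarith
    have l1 : g (k * (L / (n + 1))) ≤ g t := by
      refine hmono _ _ (by positivity) ?_ htL.le
      calc (k : ℝ) * (L / (n + 1)) = k / (n + 1) * L := by ring
        _ ≤ t / L * L := by gcongr
        _ = t := div_mul_cancel₀ _ hL.ne'
    have l2 : g t ≤ g ((k + 1 : ℕ) * (L / (n + 1))) := by
      refine hmono _ _ ht ?_ ?_
      · calc t = t / L * L := (div_mul_cancel₀ _ hL.ne').symm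
          _ ≤ ((k + 1 : ℕ) : ℝ) / (n + 1) * L := by gcongr
          _ = _ := by ring
      · rw [mul_div_assoc', div_le_iff₀ hn, mul_comm L]
        have : ((k + 1 : ℕ) : ℝ) ≤ n + 1 := by exact_mod_cast hkn
        gcongr
    have m1 : (k : ℝ) / (n + 1) * g L ≤ t / L * g L := mul_le_mul_of_nonneg_right hk1' (h0 L)
    have m2 := mul_le_mul_of_nonneg_right hk2' (h0 L)
    have m3 : ((k + 1 : ℕ) : ℝ) / (n + 1) * g L = k / (n + 1) * g L + g L * (1 / (n + 1)) := by
      push_cast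
      field_simp
    rw [abs_le]
    constructor <;> linarith
  have hlim : Filter.Tendsto (fun n : ℕ => g L * (1 / ((n : ℝ) + 1))) Filter.atTop
      (nhds (g L * 0)) := tendsto_one_div_add_atTop_nhds_zero_nat.const_mul _
  have := ge_of_tendsto' hlim hbound
  rw [mul_zero] at this
  exact sub_eq_zero.1 (abs_nonpos_iff.1 this)

/-! ### Volume of the region separating two vectors -/

set_option linter.unusedSectionVars false

section

variable {E : Type*} [NormedAddCommGroup E] [InnerProductSpace ℝ E] [FiniteDimensional ℝ E]
  [MeasurableSpace E] [BorelSpace E]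

/-- The part of the unit ball on which the linear forms of `x` and `y` have opposite signs. -/
def sepSet (x y : E) : Set E :=
  {z | z ∈ Metric.ball (0 : E) 1 ∧ (inner ℝ x z : ℝ) * inner ℝ y z < 0}

theorem measurableSet_sepSet (x y : E) : MeasurableSet (sepSet x y) :=
  measurableSet_ball.inter (measurableSet_lt
    (((by fun_prop : Continuous fun z : E => (inner ℝ x z : ℝ) * inner ℝ y z)).measurable)
    measurable_const)

theorem sepSet_comm (x y : E) : sepSet x y = sepSet y x := by
  simp only [sepSet, mul_comm]

theorem sepSet_smul (x y : E) {a b : ℝ} (ha : 0 < a) (hb : 0 < b) :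
    sepSet (a • x) (b • y) = sepSet x y := by
  ext z
  simp only [sepSet, Set.mem_ofPred_eq, real_inner_smul_left]
  rw [show a * inner ℝ x z * (b * inner ℝ y z) = (a * b) * (inner ℝ x z * inner ℝ y z) by ring]
  exact and_congr_right fun _ => ⟨fun h => neg_of_mul_neg_right h (mul_pos ha hb).le,
    fun h => mul_neg_of_pos_of_neg (mul_pos ha hb) h⟩

theorem measureReal_sepSet_map (T : E ≃ₗᵢ[ℝ] E) (x y : E) :
    volume.real (sepSet (T x) (T y)) = volume.real (sepSet x y) := by
  have h : T ⁻¹' sepSet (T x) (T y) = sepSet x y := by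
    ext z
    simp [sepSet]
  rw [← h, T.measurePreserving.measureReal_preimage (measurableSet_sepSet _ _).nullMeasurableSet]

theorem ae_inner_ne_zero {x : E} (hx : x ≠ 0) : ∀ᵐ z : E, (inner ℝ x z : ℝ) ≠ 0 := by
  have h : (LinearMap.ker (innerSL ℝ x).toLinearMap) ≠ ⊤ := by
    intro h
    have : x ∈ LinearMap.ker (innerSL ℝ x).toLinearMap := h ▸ Submodule.mem_top
    simp [hx] at this
  have := Measure.addHaar_submodule (volume : Measure E) _ h
  rw [ae_iff]
  simp only [not_not]
  exact this

theorem mul_neg_iff_or_of_betweenness {a b c : ℝ} (ha : a ≠ 0) (hb : b ≠ 0) (hc : c ≠ 0)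
    (h : 0 < a * c → 0 ≤ a * b) : a * c < 0 ↔ a * b < 0 ∨ b * c < 0 := by
  have hb2 : 0 < b ^ 2 := by positivity
  have hmul : a * b * (b * c) = b ^ 2 * (a * c) := by ring
  constructor
  · intro hac
    by_contra! hn
    have h1 := mul_nonneg hn.1 hn.2
    have h2 := mul_neg_of_pos_of_neg hb2 hac
    linarith
  · intro hor
    by_contra! hac
    have hac' : 0 < a * c := lt_of_le_of_ne hac (mul_ne_zero ha hc).symm
    have h1 : 0 < a * b := lt_of_le_of_ne (h hac') (mul_ne_zero ha hb).symm
    have h2 : b * c < 0 := hor.resolve_left h1.not_gt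
    have h3 := mul_neg_of_pos_of_neg h1 h2
    have h4 := mul_pos hb2 hac'
    linarith

/-- The hypothesis says that `y` lies between `x` and `w`. Off the null hyperplanes, `z` then
separates `x` from `w` exactly when it separates one of the pairs `x, y` and `y, w`, and it never
separates both. -/
theorem measureReal_sepSet_add {x y w : E} (hx : x ≠ 0) (hy : y ≠ 0) (hw : w ≠ 0)
    (h : ∀ z : E, 0 < (inner ℝ x z : ℝ) * inner ℝ w z → 0 ≤ (inner ℝ x z : ℝ) * inner ℝ y z) :
    volume.real (sepSet x w) = volume.real (sepSet x y) + volume.real (sepSet y w) := by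
  have hfin : ∀ a b : E, volume (sepSet a b) ≠ ⊤ := fun a b =>
    measure_ne_top_of_subset (fun z hz => hz.1) measure_ball_lt_top.ne
  rw [← measureReal_union ?_ (measurableSet_sepSet y w) (hfin _ _) (hfin _ _)]
  · refine measureReal_congr (Filter.eventuallyEq_set.2 ?_)
    filter_upwards [ae_inner_ne_zero hx, ae_inner_ne_zero hy, ae_inner_ne_zero hw] with z h1 h2 h3
    simp only [sepSet, Set.mem_union, Set.mem_ofPred_eq, ← and_or_left]
    exact and_congr_right fun _ => mul_neg_iff_or_of_betweenness h1 h2 h3 (h z)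
  · refine Set.disjoint_left.2 fun z h1 h2 => ?_
    have h4 := h z
    have h5 := h1.2
    have h6 := h2.2
    have : 0 < (inner ℝ x z : ℝ) * inner ℝ w z := by
      have h7 := mul_pos_of_neg_of_neg h5 h6
      have h8 : 0 < (inner ℝ y z : ℝ) ^ 2 * (inner ℝ x z * inner ℝ w z) := by linarith
      exact pos_of_mul_pos_right h8 (sq_nonneg _)
    linarith [h4 this]

theorem measureReal_sepSet_neg {x : E} (hx : x ≠ 0) :
    volume.real (sepSet x (-x)) = volume.real (Metric.ball (0 : E) 1) := by
  refine measureReal_congr (Filter.eventuallyEq_set.2 ?_)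
  filter_upwards [ae_inner_ne_zero hx] with z hz
  simp [sepSet, hz]

theorem sepSet_self (x : E) : sepSet x x = ∅ := by
  ext z
  simp [sepSet, mul_self_nonneg]

/-- The point at angle `t` of the circle through `e` and `f`. -/
noncomputable def circlePoint (e f : E) (t : ℝ) : E := Real.cos t • e + Real.sin t • f

theorem inner_circlePoint {e f : E} (he : ‖e‖ = 1) (hf : ‖f‖ = 1) (hef : (inner ℝ e f : ℝ) = 0)
    (s t : ℝ) : (inner ℝ (circlePoint e f s) (circlePoint e f t) : ℝ) = Real.cos (s - t) := by
  have hfe : (inner ℝ f e : ℝ) = 0 := by rw [real_inner_comm, hef]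
  simp only [circlePoint, inner_add_left, inner_add_right, real_inner_smul_left,
    real_inner_smul_right, hef, hfe, real_inner_self_eq_norm_sq, he, hf, Real.cos_sub]
  ring

theorem norm_circlePoint {e f : E} (he : ‖e‖ = 1) (hf : ‖f‖ = 1) (hef : (inner ℝ e f : ℝ) = 0)
    (t : ℝ) : ‖circlePoint e f t‖ = 1 := by
  have := inner_circlePoint he hf hef t t
  rw [real_inner_self_eq_norm_sq, sub_self, Real.cos_zero] at this
  exact (pow_eq_one_iff_of_nonneg (norm_nonneg _) two_ne_zero).1 this

theorem reflection_circlePoint {e f : E} (he : ‖e‖ = 1) (hf : ‖f‖ = 1)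
    (hef : (inner ℝ e f : ℝ) = 0) (s t : ℝ) :
    (Submodule.span ℝ {circlePoint e f s}).reflection (circlePoint e f t) =
      circlePoint e f (2 * s - t) := by
  rw [Submodule.reflection_singleton_apply, inner_circlePoint he hf hef,
    norm_circlePoint he hf hef]
  have h1 : Real.cos (2 * s - t) = 2 * Real.cos (s - t) * Real.cos s - Real.cos t := by
    have a := Real.cos_add s (s - t)
    have b := Real.cos_sub s (s - t)
    rw [show s + (s - t) = 2 * s - t by ring] at a
    rw [show s - (s - t) = t by ring] at b
    linarith
  have h2 : Real.sin (2 * s - t) = 2 * Real.cos (s - t) * Real.sin s - Real.sin t := by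
    have a := Real.sin_add s (s - t)
    have b := Real.sin_sub s (s - t)
    rw [show s + (s - t) = 2 * s - t by ring] at a
    rw [show s - (s - t) = t by ring] at b
    linarith
  simp only [circlePoint, h1, h2]
  simp only [RCLike.ofReal_real_eq_id, id, one_pow, div_one]
  module

theorem measureReal_sepSet_circlePoint {e f : E} (he : ‖e‖ = 1) (hf : ‖f‖ = 1)
    (hef : (inner ℝ e f : ℝ) = 0) {t : ℝ} (ht : 0 ≤ t) (htπ : t ≤ Real.pi) :
    volume.real (sepSet e (circlePoint e f t)) =
      t / Real.pi * volume.real (Metric.ball (0 : E) 1) := by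
  have hne : ∀ t, circlePoint e f t ≠ 0 := fun t h => by
    simpa [h] using norm_circlePoint he hf hef t
  have he0 : e = circlePoint e f 0 := by simp [circlePoint]
  -- Rotation invariance from one reflection: the reflection in the line at angle `(a + b) / 2`
  -- exchanges the angles `0` and `a + b`, and also `a` and `b`.
  have hrot : ∀ a b, volume.real (sepSet (circlePoint e f a) (circlePoint e f (a + b))) =
      volume.real (sepSet e (circlePoint e f b)) := fun a b => by
    have he1 : sepSet e (circlePoint e f b) = sepSet (circlePoint e f 0) (circlePoint e f b) := by
      rw [← he0]
    conv_rhs => rw [he1, ← measureReal_sepSet_map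
      (Submodule.span ℝ {circlePoint e f ((a + b) / 2)}).reflection,
      reflection_circlePoint he hf hef, reflection_circlePoint he hf hef, sepSet_comm]
    congr 3 <;> ring_nf
  have hπ : circlePoint e f Real.pi = -e := by simp [circlePoint]
  have he' : e ≠ 0 := he0 ▸ hne 0
  rw [← measureReal_sepSet_neg he', ← hπ]
  refine eq_div_mul_of_additive_of_nonneg (g := fun t => volume.real (sepSet e (circlePoint e f t)))
    Real.pi_pos (fun _ => measureReal_nonneg) (fun a b ha hb hab => ?_) ht htπ
  rw [← hrot a b]
  refine measureReal_sepSet_add he' (hne a) (hne _) fun z hz => ?_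
  -- At `a + b = π` the endpoints are antipodal and the betweenness hypothesis is vacuous.
  rcases hab.eq_or_lt with hab | hab
  · rw [hab, hπ, inner_neg_left] at hz
    nlinarith [mul_self_nonneg (inner ℝ e z : ℝ)]
  rcases (add_nonneg ha hb).eq_or_lt with h0 | h0
  · obtain rfl : a = 0 := by linarith
    rw [← he0]
    exact mul_self_nonneg _
  have hs : 0 < Real.sin (a + b) := Real.sin_pos_of_pos_of_lt_pi h0 hab
  -- The middle point is a nonnegative combination of the endpoints, which gives betweenness.
  have hid : Real.sin (a + b) • circlePoint e f a =
      Real.sin b • e + Real.sin a • circlePoint e f (a + b) := by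
    have h1 : Real.sin (a + b) * Real.cos a = Real.sin b + Real.sin a * Real.cos (a + b) := by
      have := Real.sin_sub (a + b) a
      rw [add_sub_cancel_left] at this
      linarith
    simp only [circlePoint, smul_add, smul_smul, h1, mul_comm (Real.sin (a + b))]
    module
  have h2 := congrArg (fun y => (inner ℝ y z : ℝ)) hid
  simp only [inner_add_left, real_inner_smul_left] at h2
  have hsa : 0 ≤ Real.sin a := Real.sin_nonneg_of_nonneg_of_le_pi ha (by linarith)
  have hsb : 0 ≤ Real.sin b := Real.sin_nonneg_of_nonneg_of_le_pi hb (by linarith)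
  refine nonneg_of_mul_nonneg_right (a := Real.sin (a + b)) ?_ hs
  calc 0 ≤ Real.sin b * (inner ℝ e z * inner ℝ e z) +
      Real.sin a * (inner ℝ e z * inner ℝ (circlePoint e f (a + b)) z) := by
        have := mul_self_nonneg (inner ℝ e z : ℝ)
        positivity
    _ = inner ℝ e z * (Real.sin (a + b) * inner ℝ (circlePoint e f a) z) := by rw [h2]; ring
    _ = _ := by ring

theorem measureReal_sepSet {x y : E} (hx : x ≠ 0) (hy : y ≠ 0) :
    volume.real (sepSet x y) =
      InnerProductGeometry.angle x y / Real.pi * volume.real (Metric.ball (0 : E) 1) := by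
  wlog hunit : ‖x‖ = 1 ∧ ‖y‖ = 1 generalizing x y
  · have hx' := norm_pos_iff.2 hx
    have hy' := norm_pos_iff.2 hy
    have := @this (‖x‖⁻¹ • x) (‖y‖⁻¹ • y) (smul_ne_zero (inv_pos.2 hx').ne' hx)
      (smul_ne_zero (inv_pos.2 hy').ne' hy)
      ⟨by rw [norm_smul, norm_inv, norm_norm, inv_mul_cancel₀ hx'.ne'],
        by rw [norm_smul, norm_inv, norm_norm, inv_mul_cancel₀ hy'.ne']⟩
    rwa [sepSet_smul _ _ (inv_pos.2 hx') (inv_pos.2 hy'),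
      InnerProductGeometry.angle_smul_left_of_pos _ _ (inv_pos.2 hx'),
      InnerProductGeometry.angle_smul_right_of_pos _ _ (inv_pos.2 hy')] at this
  obtain ⟨hx1, hy1⟩ := hunit
  set θ := InnerProductGeometry.angle x y with hθ
  have hcos : Real.cos θ = inner ℝ x y := by
    rw [hθ, InnerProductGeometry.cos_angle, hx1, hy1]
    simp
  have h0 : 0 ≤ θ := InnerProductGeometry.angle_nonneg x y
  have hπ : θ ≤ Real.pi := InnerProductGeometry.angle_le_pi x y
  -- Angles `0` and `π` are treated apart: there `x` and `y` are parallel and span no plane in which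
  -- to choose `f`.
  rcases h0.eq_or_lt with h | hpos
  · obtain ⟨-, r, hr, rfl⟩ := InnerProductGeometry.angle_eq_zero_iff.1 h.symm
    rw [← h]
    have := sepSet_smul x x one_pos hr
    rw [one_smul] at this
    rw [this, sepSet_self]
    simp
  rcases hπ.eq_or_lt with h | hlt
  · obtain ⟨-, r, hr, rfl⟩ := InnerProductGeometry.angle_eq_pi_iff.1 h
    have := sepSet_smul x (-x) one_pos (neg_pos.2 hr)
    rw [one_smul, smul_neg, neg_smul, neg_neg] at this
    rw [this, measureReal_sepSet_neg hx, h, div_self Real.pi_ne_zero, one_mul]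
  have hs : 0 < Real.sin θ := Real.sin_pos_of_pos_of_lt_pi hpos hlt
  set f := (Real.sin θ)⁻¹ • (y - Real.cos θ • x) with hf
  have hy' : y = circlePoint x f θ := by
    rw [circlePoint, hf, smul_inv_smul₀ hs.ne']
    module
  have hxf : (inner ℝ x f : ℝ) = 0 := by
    rw [hf, real_inner_smul_right, inner_sub_right, real_inner_smul_right,
      real_inner_self_eq_norm_sq, hx1, hcos]
    simp
  have hf1 : ‖f‖ = 1 := by
    have h1 : ‖y - Real.cos θ • x‖ ^ 2 = Real.sin θ ^ 2 := by
      rw [norm_sub_sq_real, norm_smul, real_inner_smul_right, real_inner_comm, ← hcos, hx1, hy1,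
        Real.sin_sq, Real.norm_eq_abs, mul_one, sq_abs]
      ring
    have h2 := (pow_left_inj₀ (norm_nonneg _) hs.le two_ne_zero).1 h1
    rw [hf, norm_smul, h2, norm_inv, Real.norm_of_nonneg hs.le, inv_mul_cancel₀ hs.ne']
  conv_lhs => rw [hy']
  exact measureReal_sepSet_circlePoint hx1 hf1 hxf h0 hπ

end

/-! ### SimHash and angular similarity -/

/-- The surface measure of a set is `d` times the volume of the open radial segments over it. For a
cone these fill its part of the ball except possibly the origin, and normalizing cancels `d`. -/
theorem uniformSphere_real_preimage_cone {d : ℕ} [NeZero d] {A : Set (EuclideanSpace ℝ (Fin d))}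
    (hA : MeasurableSet A) (hcone : ∀ r : ℝ, 0 < r → ∀ z, r • z ∈ A ↔ z ∈ A) :
    (uniformSphere d).real (Subtype.val ⁻¹' A) =
      volume.real (Metric.ball 0 1 ∩ A) /
        volume.real (Metric.ball (0 : EuclideanSpace ℝ (Fin d)) 1) := by
  have hset : Set.Ioo (0 : ℝ) 1 • (Subtype.val ''
      (Subtype.val ⁻¹' A : Set (Metric.sphere (0 : EuclideanSpace ℝ (Fin d)) 1))) =
      (Metric.ball 0 1 ∩ A) \ {0} := by
    ext z
    simp only [Set.mem_smul, Set.mem_image, Set.mem_preimage, Set.mem_sdiff, Set.mem_inter_iff,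
      Set.mem_singleton_iff, mem_ball_zero_iff]
    constructor
    · rintro ⟨r, hr, _, ⟨w, hw, rfl⟩, rfl⟩
      have hw1 : ‖(w : EuclideanSpace ℝ (Fin d))‖ = 1 := by simp
      refine ⟨⟨?_, (hcone r hr.1 _).2 hw⟩, ?_⟩
      · rw [norm_smul, hw1, mul_one, Real.norm_of_nonneg hr.1.le]
        exact hr.2
      · refine smul_ne_zero hr.1.ne' fun h => ?_
        simp [h] at hw1
    · rintro ⟨⟨hz1, hzA⟩, hz0⟩
      have hz : 0 < ‖z‖ := norm_pos_iff.2 hz0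
      refine ⟨‖z‖, ⟨hz, hz1⟩, ‖z‖⁻¹ • z, ⟨⟨‖z‖⁻¹ • z, ?_⟩, ?_, rfl⟩, smul_inv_smul₀ hz.ne' z⟩
      · rw [mem_sphere_zero_iff_norm, norm_smul, norm_inv, norm_norm, inv_mul_cancel₀ hz.ne']
      · exact (hcone _ (inv_pos.2 hz) z).2 hzA
  have hd : (d : ℝ) ≠ 0 := Nat.cast_ne_zero.2 (NeZero.ne d)
  rw [uniformSphere, measureReal_ennreal_smul_apply, Measure.toSphere_apply_univ, Measure.real,
    Measure.toSphere_apply' _ (hA.preimage measurable_subtype_coe), hset,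
    measure_sdiff_null (measure_singleton _)]
  simp only [finrank_euclideanSpace, Fintype.card_fin, ENNReal.toReal_inv, ENNReal.toReal_mul,
    ENNReal.toReal_natCast]
  change ((d : ℝ) * volume.real _)⁻¹ * (d * volume.real _) = _
  field_simp

theorem sign_eq_sign_iff_pos_neg (a b : ℝ) : SignType.sign a = SignType.sign b ↔
    (0 < a ↔ 0 < b) ∧ (a < 0 ↔ b < 0) := by
  rcases lt_trichotomy a 0 with ha | ha | ha <;> rcases lt_trichotomy b 0 with hb | hb | hb <;>
    simp [ha, hb, ha.le, hb.le, not_lt.2, sign_neg, sign_pos]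

theorem collisionProb_simHash {d : ℕ} [NeZero d] {P : Finset (EuclideanSpace ℝ (Fin d))}
    (hP : 0 ∉ P) (x y : P) :
    (simHash P).collisionProb x y = angularSim (x : EuclideanSpace ℝ (Fin d)) y := by
  obtain ⟨x, hx⟩ := x
  obtain ⟨y, hy⟩ := y
  have hx0 : x ≠ 0 := fun h => hP (h ▸ hx)
  have hy0 : y ≠ 0 := fun h => hP (h ▸ hy)
  set B : Set (EuclideanSpace ℝ (Fin d)) :=
    {z | SignType.sign (inner ℝ x z : ℝ) = SignType.sign (inner ℝ y z : ℝ)} with hB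
  have hm : ∀ w : EuclideanSpace ℝ (Fin d), Measurable fun z => (inner ℝ w z : ℝ) :=
    fun w => by fun_prop
  have hBm : MeasurableSet B := by
    simp only [hB, sign_eq_sign_iff_pos_neg]
    exact ((measurableSet_lt measurable_const (hm _)).iff
      (measurableSet_lt measurable_const (hm _))).inter
      ((measurableSet_lt (hm _) measurable_const).iff (measurableSet_lt (hm _) measurable_const))
  change (uniformSphere d).real (Subtype.val ⁻¹' B) = _
  rw [uniformSphere_real_preimage_cone hBm]
  · have hV : 0 < volume.real (Metric.ball (0 : EuclideanSpace ℝ (Fin d)) 1) :=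
      ENNReal.toReal_pos (Metric.measure_ball_pos _ _ one_pos).ne' measure_ball_lt_top.ne
    -- The sign `0` occurs only on two null hyperplanes; elsewhere equal signs mean not being
    -- separated.
    have h1 : volume.real (Metric.ball 0 1 ∩ B) =
        volume.real (Metric.ball (0 : EuclideanSpace ℝ (Fin d)) 1 \ sepSet x y) := by
      refine measureReal_congr (Filter.eventuallyEq_set.2 ?_)
      filter_upwards [ae_inner_ne_zero hx0, ae_inner_ne_zero hy0] with z h1 h2
      simp only [hB, sepSet, Set.mem_inter_iff, Set.mem_sdiff, Set.mem_ofPred_eq, not_and]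
      refine and_congr_right fun hz => ?_
      rcases h1.lt_or_gt with h1 | h1 <;> rcases h2.lt_or_gt with h2 | h2 <;>
        simp [h1, h2, hz, sign_neg, sign_pos, mul_neg_iff, not_lt.2, h1.le, h2.le]
    have hsub : sepSet x y ⊆ Metric.ball 0 1 := fun z hz => hz.1
    rw [h1, measureReal_sdiff hsub (measurableSet_sepSet x y)
      measure_ball_lt_top.ne,
      measureReal_sepSet hx0 hy0, angularSim]
    field_simp
  · intro r hr z
    simp [hB, real_inner_smul_right, sign_mul, sign_pos hr]

/-! ### Symmetry and conclusion -/

theorem jaccardSim_comm {U : Type u} [DecidableEq U] (A B : Finset U) :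
    jaccardSim A B = jaccardSim B A := by
  rw [jaccardSim, jaccardSim, Finset.union_comm, Finset.inter_comm]

theorem angularSim_comm {d : ℕ} (x y : EuclideanSpace ℝ (Fin d)) :
    angularSim x y = angularSim y x := by
  rw [angularSim, angularSim, InnerProductGeometry.angle_comm]

namespace HashFamily

/-- A family whose collision probability is a symmetric similarity yields sensitive families:
its concatenations for small `ε`, and the matching family otherwise. -/
theorem exists_isSensitive_of_collisionProb_eq {X : Type u} [Fintype X] (H : HashFamily X)
    (μ : X → X → ℝ) (hH : ∀ p q, H.collisionProb p q = μ p q) (hsymm : ∀ p q, μ p q = μ q p)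
    {ε α : ℝ} (hε : 0 < ε) (hε1 : ε < 1) (hα : 0 < α) :
    ∃ K : HashFamily X, K.IsSensitive μ (1 - ε⁻¹ * α) (1 - α) (min 1 (12 * ε)) ∧
      (12 * ε ≤ 1 → ∃ l : ℕ, K = H.concat l) := by
  by_cases hC : 12 * ε ≤ 1
  · obtain ⟨l, hl⟩ := exists_concat_isSensitive H μ hH hε hα hC
    exact ⟨H.concat l, by rwa [min_eq_right hC], fun _ => ⟨l, rfl⟩⟩
  · have hr : 1 - ε⁻¹ * α < 1 - α := by
      have : 1 < ε⁻¹ := (one_lt_inv₀ hε).2 hε1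
      nlinarith
    obtain ⟨K, hK⟩ := exists_isSensitive_one μ
      (fun p => by rw [← hH, collisionProb_self]) hsymm hr (by linarith)
    exact ⟨K, by rwa [min_eq_left (not_le.1 hC).le], fun h => absurd h hC⟩

end HashFamily

theorem mainTheorem5 :
    ∃ C : ℝ, 0 < C ∧ ∀ ε α : ℝ, 0 < ε → ε < 1 → 0 < α → α < 1 →
      (∀ (d : ℕ) [NeZero d] (P : Finset (EuclideanSpace ℝ (Fin d))), 0 ∉ P →
        ∃ H : HashFamily P,
          H.IsSensitive (fun x y => angularSim (x : EuclideanSpace ℝ (Fin d)) y)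
            (1 - ε⁻¹ * α) (1 - α) (min 1 (C * ε)) ∧
          (C * ε ≤ 1 → ∃ l : ℕ, H = (simHash P).concat l)) ∧
      (∀ (U : Type*) [DecidableEq U] (P : Finset (Finset U)),
        ∃ H : HashFamily P,
          H.IsSensitive (fun A B => jaccardSim (A : Finset U) B)
            (1 - ε⁻¹ * α) (1 - α) (min 1 (C * ε)) ∧
          (C * ε ≤ 1 → ∃ l : ℕ, H = (minHash P).concat l)) := by
  refine ⟨12, by norm_num, fun ε α hε hε1 hα _ => ⟨fun d _ P hP => ?_, fun U _ P => ?_⟩⟩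
  · exact HashFamily.exists_isSensitive_of_collisionProb_eq _ _
      (fun p q => collisionProb_simHash hP p q) (fun _ _ => angularSim_comm _ _) hε hε1 hα
  · exact HashFamily.exists_isSensitive_of_collisionProb_eq _ _
      (fun p q => collisionProb_minHash P p q) (fun _ _ => jaccardSim_comm _ _) hε hε1 hα
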